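/- Let $d\ge 1$ and let $v_0,\dots,v_{d-1}\in\{1,-1\}$ with $v_0=1$. Let $P$ (resp. $Q$) be the set of $1\le i\le d-1$ with $v_{i-1}\ne v_i$ (resp. $v_{i-1}=v_i$). With $a,k$ ranging over $\mathbb N=\{0,1,\dots\}$, $p$ over $P$ and $q$ over $Q$, put: if $v_{d-1}=1$, $J=\{(da+p)d^{k}-1\}$ and $K=\{(da+q)d^{k}-1\}$; if $v_{d-1}=-1$, $J=\{(da+p)d^{2k}-1\}\cup\{(da+q)d^{2k+1}-1\}$ and $K=\{(da+q)d^{2k}-1\}\cup\{(da+p)d^{2k+1}-1\}$. Let $\bar J=J$ if $v_{d-1}=1$ and $\bar J=K$ if $v_{d-1}=-1$. For $0\le\ell\le m$ let $\mathfrak J_{m,\ell}$ (resp. $\bar{\mathfrak J}_{m,\ell}$) be the set of permutations $\sigma$ of $\{0,\dots,m-1\}$ with $i+\sigma_i\in J$ (resp. $\in\bar J$) for all $i\in\{0,\dots,m-1\}\setminus\{\ell\}$, and put $$\bar X_n=\sum_{i=0}^{n-1}\#\bar{\mathfrak J}_{n,i},\qquad \bar Y_n=\#\bar{\mathfrak J}_{n,n},\qquad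 \bar Z_n=\#\bar{\mathfrak J}_{n,n-1}.$$ Let $A_i=\{x\in\mathbb N: x\equiv i \pmod d\}$ for $0\le i\le d-1$, and let $a_0,\dots,a_{d-1}$ be letters standing for these classes. Let $\mathfrak J'_{m,\ell}\subseteq\mathfrak J_{m,\ell}$ consist of those $\sigma$ for which, for each $0\le i\le d-1$, there is at most one $x\ne\ell$ in $A_i$ with $(x+\sigma_x+1)\bmod d\in P$. Let $n\ge 2$, $0\le h\le d-1$ and $m=dn+h$. A permutation $\sigma$ of $\{0,\dots,m-1\}$ has type $t=s_0\cdots s_{d-1}$ (if $\ell=m$), or $t=s_0\cdots s_{d-1}s_d$ (if $\ell<m$), relative to $\ell$, where the $s_i$ are letters, if for each $0\le i\le d-1$ the classes of the values $\sigma_x$, $x\in A_i\cap\{0,\dots,m-1\}$, $x\ne\ell$, are, in some order, $a_{d-i-1},\dots,a_{d-i-1},s_i$, and, if $\ell<m$, the class of $\sigma_\ell$ is $s_d$. Let $\mathfrak J^t_{m,\ell}$ be the set of $\sigma\in\mathfrak J'_{m,\ell}$ of type $t$. For $0\le k\le d-1$ let $$\mathfrak P_Y=\mathfrak J^t_{m,m},\qquad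 \mathfrak P_Z=\mathfrak J^t_{m,m-1},\qquad \mathfrak P_X=\bigsqcup_{0\le\ell<m,\ \ell\in A_k}\mathfrak J^t_{m,\ell}.$$ Let $\mathfrak P$ be one of $\mathfrak P_Y,\mathfrak P_Z,\mathfrak P_X$, and let $t$ be a possible type for it, that is: for each $0\le i\le d-1$, $s_i=a_j$ with $(i+j+1)\bmod d\in P\cup\{0\}$, and some permutation of $\{0,\dots,m-1\}$, not necessarily in $\mathfrak J_{m,\ell}$, has type $t$ relative to $\ell=m$ (resp. $\ell=m-1$, some $\ell<m$ in $A_k$). For $0\le i\le d-1$ let $\eta_0,\eta_1,\eta_2,\eta_3\in\{0,1\}$ be the truth values of $i+1\le h$; of $d-i\le h$; of $s_i=a_{d-i-1}$; and of ($\mathfrak P\neq\mathfrak P_Y$ and $s_d=a_{d-i-1}$). Let $\mu_i=\Psi_Z(\eta_0\eta_1\eta_2\eta_3)$ if $\mathfrak P=\mathfrak P_Z$ and $m-1\in A_i$; $\mu_i=\Psi_X(\eta_0\eta_1\eta_2\eta_3)$ if $\mathfrak P=\mathfrak P_X$ and $k=i$; and $\mu_i=\Psi_G(\eta_0\eta_1\eta_2)$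 otherwise, where $$\begin{array}{c|cccccccc}\eta&000&001&010&011&100&101&110&111\\ \Psi_G&\bar X_n&\bar Y_n&0&\bar Z_{n+1}&\bar Z_{n+1}&0&\bar X_{n+1}&\bar Y_{n+1}\\ \hline \eta&0000&0010&0100&0110&1000&1010&1100&1110\\ \Psi_Z&0&\bar Z_n&0&0&\bar X_n&\bar Y_n&0&\bar Z_{n+1}\\ \Psi_X&0&\bar X_n&0&0&0&\bar Z_{n+1}&0&\bar X_{n+1}\\ \hline \eta&0001&0011&0101&0111&1001&1011&1101&1111\\ \Psi_Z&0&\bar Z_n&0&0&\bar X_n&0&0&\bar Z_{n+1}\\ \Psi_X&0&\bar X_n&0&0&0&0&0&\bar X_{n+1}\end{array}$$ Then $$\#\mathfrak P\equiv\mu_0\,\mu_1\cdots\mu_{d-1}\pmod 2 .$$ -/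

import Mathlib

/-! A finite sequence `v_0, …, v_{d-1}` is given as `v : ℕ → ℤ`; only its first `d` values are used.
The letter `a_j` (`0 ≤ j < d`), which stands for the residue class `A_j` of `j` modulo `d`,
is represented by `j : Fin d`. -/

/-- `P = {1 ≤ i ≤ d - 1 | v_{i-1} ≠ v_i}`. -/
def setP (d : ℕ) (v : ℕ → ℤ) : Set ℕ := {i | 1 ≤ i ∧ i < d ∧ v (i - 1) ≠ v i}

/-- `Q = {1 ≤ i ≤ d - 1 | v_{i-1} = v_i}`. -/
def setQ (d : ℕ) (v : ℕ → ℤ) : Set ℕ := {i | 1 ≤ i ∧ i < d ∧ v (i - 1) = v i}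

open Classical in
/-- The set `J`; the equations `x = y - 1` are written `x + 1 = y`. -/
noncomputable def setJ (d : ℕ) (v : ℕ → ℤ) : Set ℕ :=
  if v (d - 1) = -1 then
    {x | ∃ a k : ℕ, ∃ p ∈ setP d v, x + 1 = (d * a + p) * d ^ (2 * k)} ∪
    {x | ∃ a k : ℕ, ∃ q ∈ setQ d v, x + 1 = (d * a + q) * d ^ (2 * k + 1)}
  else
    {x | ∃ a k : ℕ, ∃ p ∈ setP d v, x + 1 = (d * a + p) * d ^ k}

open Classical in
/-- The set `K`. -/
noncomputable def setK (d : ℕ) (v : ℕ → ℤ) : Set ℕ :=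
  if v (d - 1) = -1 then
    {x | ∃ a k : ℕ, ∃ q ∈ setQ d v, x + 1 = (d * a + q) * d ^ (2 * k)} ∪
    {x | ∃ a k : ℕ, ∃ p ∈ setP d v, x + 1 = (d * a + p) * d ^ (2 * k + 1)}
  else
    {x | ∃ a k : ℕ, ∃ q ∈ setQ d v, x + 1 = (d * a + q) * d ^ k}

open Classical in
/-- `J̄` is `K` if `v_{d-1} = -1`, and `J` if `v_{d-1} = 1`. -/
noncomputable def setJbar (d : ℕ) (v : ℕ → ℤ) : Set ℕ :=
  if v (d - 1) = -1 then setK d v else setJ d v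

/-- For a set `S` of nonnegative integers: the permutations `σ` of `{0, …, m-1}` such that
`i + σ_i ∈ S` for all `i ≠ ℓ` (for all `i`, if `ℓ = m`).
For `S = J` and `S = K` these are `𝔍_{m,ℓ}` and `𝔎_{m,ℓ}`. -/
def permSet (S : Set ℕ) (m l : ℕ) : Set (Equiv.Perm (Fin m)) :=
  {σ | ∀ i : Fin m, (i : ℕ) ≠ l → (i : ℕ) + (σ i : ℕ) ∈ S}

/-- `X̄_n`. -/
noncomputable def Xbar (d : ℕ) (v : ℕ → ℤ) (n : ℕ) : ℕ :=
  ∑ i ∈ Finset.range n, (permSet (setJbar d v) n i).ncard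

/-- `Ȳ_n`. -/
noncomputable def Ybar (d : ℕ) (v : ℕ → ℤ) (n : ℕ) : ℕ :=
  (permSet (setJbar d v) n n).ncard

/-- `Z̄_n`, for `n ≥ 1`. -/
noncomputable def Zbar (d : ℕ) (v : ℕ → ℤ) (n : ℕ) : ℕ :=
  (permSet (setJbar d v) n (n - 1)).ncard

/-- `𝔍'_{m,ℓ}`: the permutations in `𝔍_{m,ℓ}` with at most one unsociable biletter in each block,
that is, for each `i < d` at most one column `(x, σ_x)` with `x ≠ ℓ`, `x ∈ A_i`, `σ_x ∈ A_j`
and `i + j + 1 (mod d) ∈ P`. -/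
def permSet' (d : ℕ) (v : ℕ → ℤ) (m l : ℕ) : Set (Equiv.Perm (Fin m)) :=
  {σ | σ ∈ permSet (setJ d v) m l ∧
    ∀ i < d, {x : Fin m | (x : ℕ) ≠ l ∧ (x : ℕ) % d = i ∧
      ((x : ℕ) % d + (σ x : ℕ) % d + 1) % d ∈ setP d v}.ncard ≤ 1}

/-- For every `i < d`, the columns of `σ` with top letter in `A_i`, other than the one at `ℓ`,
have in some order the bottom letters `a_{d-i-1}, …, a_{d-i-1}, s_i`. -/
def HasForm (d m l : ℕ) (s : Fin d → Fin d) (σ : Equiv.Perm (Fin m)) : Prop :=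
  ∀ i : Fin d, ∃ x : Fin m, (x : ℕ) ≠ l ∧ (x : ℕ) % d = i ∧ (σ x : ℕ) % d = s i ∧
    ∀ y : Fin m, y ≠ x → (y : ℕ) ≠ l → (y : ℕ) % d = i → (σ y : ℕ) % d = d - i - 1

/-- The bottom letter at `ℓ < m` is `a_{s_d}`. -/
def HasSpecific (d m l : ℕ) (sd : Fin d) (σ : Equiv.Perm (Fin m)) : Prop :=
  ∃ x : Fin m, (x : ℕ) = l ∧ (σ x : ℕ) % d = sd

/-- The condition on the word `s_0 ⋯ s_{d-1}`: `s_i = a_j` with `i + j + 1 (mod d) ∈ P ∪ {0}`. -/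
def LetterCond (d : ℕ) (v : ℕ → ℤ) (s : Fin d → Fin d) : Prop :=
  ∀ i : Fin d, ((i : ℕ) + (s i : ℕ) + 1) % d ∈ setP d v ∪ {0}

/-- `𝔓_Y = 𝔍_{m,m}^t` for `t = s_0 ⋯ s_{d-1}`. -/
def setPY (d : ℕ) (v : ℕ → ℤ) (m : ℕ) (s : Fin d → Fin d) : Set (Equiv.Perm (Fin m)) :=
  {σ | σ ∈ permSet' d v m m ∧ HasForm d m m s σ}

/-- `𝔍_{m,ℓ}^t` for `ℓ < m` and `t = s_0 ⋯ s_{d-1} s_d`. -/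
def permSetType (d : ℕ) (v : ℕ → ℤ) (m l : ℕ) (s : Fin d → Fin d) (sd : Fin d) :
    Set (Equiv.Perm (Fin m)) :=
  {σ | σ ∈ permSet' d v m l ∧ HasForm d m l s σ ∧ HasSpecific d m l sd σ}

/-- `𝔓_Z = 𝔍_{m,m-1}^t`. -/
def setPZ (d : ℕ) (v : ℕ → ℤ) (m : ℕ) (s : Fin d → Fin d) (sd : Fin d) :
    Set (Equiv.Perm (Fin m)) :=
  permSetType d v m (m - 1) s sd

/-- The cardinality of `𝔓_X`, the sum of the `𝔍_{m,ℓ}^t` over the `ℓ < m` with `ℓ ∈ A_k`. -/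
noncomputable def cardPX (d : ℕ) (v : ℕ → ℤ) (m : ℕ) (k : Fin d) (s : Fin d → Fin d)
    (sd : Fin d) : ℕ :=
  ∑ l ∈ (Finset.range m).filter (fun l => l % d = k), (permSetType d v m l s sd).ncard

/-- `t = s_0 ⋯ s_{d-1}` is a possible type for `ℓ = m`: it satisfies the letter condition and is
the type of a permutation of `{0, …, m-1}` (which need not lie in `𝔍_{m,m}`). -/
def IsTypeY (d : ℕ) (v : ℕ → ℤ) (m : ℕ) (s : Fin d → Fin d) : Prop :=
  LetterCond d v s ∧ ∃ σ : Equiv.Perm (Fin m), HasForm d m m s σ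

/-- `t = s_0 ⋯ s_{d-1} s_d` is a possible type for `ℓ = m - 1`. -/
def IsTypeZ (d : ℕ) (v : ℕ → ℤ) (m : ℕ) (s : Fin d → Fin d) (sd : Fin d) : Prop :=
  LetterCond d v s ∧
    ∃ σ : Equiv.Perm (Fin m), HasForm d m (m - 1) s σ ∧ HasSpecific d m (m - 1) sd σ

/-- `t = s_0 ⋯ s_{d-1} s_d` is a possible type for some `ℓ < m` with `ℓ ∈ A_k`. -/
def IsTypeX (d : ℕ) (v : ℕ → ℤ) (m : ℕ) (k : Fin d) (s : Fin d → Fin d) (sd : Fin d) : Prop :=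
  LetterCond d v s ∧ ∃ l < m, l % d = k ∧
    ∃ σ : Equiv.Perm (Fin m), HasForm d m l s σ ∧ HasSpecific d m l sd σ

/-- `η_0 = 1` if and only if `i + 1 ≤ h`. -/
def eta0 {d : ℕ} (h : ℕ) (i : Fin d) : Bool := decide ((i : ℕ) + 1 ≤ h)

/-- `η_1 = 1` if and only if `d - i ≤ h`. -/
def eta1 {d : ℕ} (h : ℕ) (i : Fin d) : Bool := decide (d - (i : ℕ) ≤ h)

/-- `η_2 = 1` if and only if `s_i = a_{d-i-1}`. -/
def eta2 {d : ℕ} (s : Fin d → Fin d) (i : Fin d) : Bool := decide ((s i : ℕ) = d - i - 1)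

/-- `η_3 = 1` if and only if `s_d = a_{d-i-1}`. -/
def eta3 {d : ℕ} (sd : Fin d) (i : Fin d) : Bool := decide ((sd : ℕ) = d - i - 1)

/-- The table of `Ψ_G(η_0, η_1, η_2)`. -/
noncomputable def PsiG (d : ℕ) (v : ℕ → ℤ) (n : ℕ) : Bool → Bool → Bool → ℕ
  | false, false, false => Xbar d v n
  | false, false, true  => Ybar d v n
  | false, true,  false => 0
  | false, true,  true  => Zbar d v (n + 1)
  | true,  false, false => Zbar d v (n + 1)
  | true,  false, true  => 0
  | true,  true,  false => Xbar d v (n + 1)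
  | true,  true,  true  => Ybar d v (n + 1)

/-- The table of `Ψ_Z(η_0, η_1, η_2, η_3)`. -/
noncomputable def PsiZ (d : ℕ) (v : ℕ → ℤ) (n : ℕ) : Bool → Bool → Bool → Bool → ℕ
  | false, false, false, false => 0
  | false, false, true,  false => Zbar d v n
  | false, true,  false, false => 0
  | false, true,  true,  false => 0
  | true,  false, false, false => Xbar d v n
  | true,  false, true,  false => Ybar d v n
  | true,  true,  false, false => 0
  | true,  true,  true,  false => Zbar d v (n + 1)
  | false, false, false, true  => 0
  | false, false, true,  true  => Zbar d v n
  | false, true,  false, true  => 0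
  | false, true,  true,  true  => 0
  | true,  false, false, true  => Xbar d v n
  | true,  false, true,  true  => 0
  | true,  true,  false, true  => 0
  | true,  true,  true,  true  => Zbar d v (n + 1)

/-- The table of `Ψ_X(η_0, η_1, η_2, η_3)`. -/
noncomputable def PsiX (d : ℕ) (v : ℕ → ℤ) (n : ℕ) : Bool → Bool → Bool → Bool → ℕ
  | false, false, false, false => 0
  | false, false, true,  false => Xbar d v n
  | false, true,  false, false => 0
  | false, true,  true,  false => 0
  | true,  false, false, false => 0
  | true,  false, true,  false => Zbar d v (n + 1)
  | true,  true,  false, false => 0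
  | true,  true,  true,  false => Xbar d v (n + 1)
  | false, false, false, true  => 0
  | false, false, true,  true  => Xbar d v n
  | false, true,  false, true  => 0
  | false, true,  true,  true  => 0
  | true,  false, false, true  => 0
  | true,  false, true,  true  => 0
  | true,  true,  false, true  => 0
  | true,  true,  true,  true  => Xbar d v (n + 1)

/-- The factor `μ_i` for `𝔓_Y`. -/
noncomputable def muY (d : ℕ) (v : ℕ → ℤ) (n h : ℕ) (s : Fin d → Fin d) (i : Fin d) : ℕ :=
  PsiG d v n (eta0 h i) (eta1 h i) (eta2 s i)

/-- The factor `μ_i` for `𝔓_Z`, with `m = d n + h`. -/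
noncomputable def muZ (d : ℕ) (v : ℕ → ℤ) (n h : ℕ) (s : Fin d → Fin d) (sd i : Fin d) : ℕ :=
  if (d * n + h - 1) % d = i then PsiZ d v n (eta0 h i) (eta1 h i) (eta2 s i) (eta3 sd i)
  else PsiG d v n (eta0 h i) (eta1 h i) (eta2 s i)

/-- The factor `μ_i` for `𝔓_X`, the sum over `ℓ ∈ A_k`. -/
noncomputable def muX (d : ℕ) (v : ℕ → ℤ) (n h : ℕ) (k : Fin d) (s : Fin d → Fin d)
    (sd i : Fin d) : ℕ :=
  if k = i then PsiX d v n (eta0 h i) (eta1 h i) (eta2 s i) (eta3 sd i)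
  else PsiG d v n (eta0 h i) (eta1 h i) (eta2 s i)

/-! A column `(x, σ_x)` with `x ∈ A_i` and `σ_x ∈ A_j` has `x + σ_x ∈ J` automatically if
`(i + j + 1) mod d ∈ P`. If `j = d - i - 1`, then `x + σ_x + 1 = d (⌊x/d⌋ + ⌊σ_x/d⌋ + 1)`, and
`x + σ_x ∈ J` if and only if `⌊x/d⌋ + ⌊σ_x/d⌋ ∈ J̄` (`mem_setJ_iff_mem_setJbar`). For a permutation
of type `t`, every column other than that at `l` is of one of these two kinds, so the condition on
`J`, and the one that defines `𝔍'`, amount to a condition on `J̄` for the columns of the second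
kind (`hasForm_and_mem_permSet'_iff`).

Fix the *exceptional* places: `l`, and, for each `i` with `s_i ≠ a_{d-i-1}`, the place in `A_i` with
a value in the class `s_i`. The class of `σ_x` is then prescribed for every `x`. If the places are
regrouped by that class instead of their own, the permutations in question are those that are
supported by a block diagonal `0`-`1` matrix, and their number is a product over the blocks. In the
block `i` the rows are the quotients `⌊x/d⌋` of the places of `A_i` that are not exceptional,
subject to the condition on `J̄`, and a number of unconstrained rows that depends on `t` only. The
factor of the block `i` thus depends only on the exceptional places in `A_i`, and the sum over all
choices of exceptional places factors as well (`ncard_typedPerms_eq_prod`). The same product with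
`J̄` replaced by all natural numbers shows that a possible type balances the numbers of rows and
columns in every block (`card_rows_add_freeRows`).

What remains is one block. With two or more unconstrained rows the count is even, because the
images of two of them can be exchanged (`even_blockCount`). With one, a removed row can be identified with the
unconstrained one, which gives `X̄` or `Z̄`; with none, the count is `Ȳ`, or it gives `Z̄` after
inversion (`sum_blockCount_range_succ_erase`). In the case of `𝔓_X`, if the block `k` also has an
exceptional place other than `l`, the count is even by exchanging the two places
(`even_sum_blockSum_erase_one`). -/

/-! ### Counting bijections compatible with a relation -/

/-- The number of bijections `σ : X ≃ Y` with `M x (σ x)` for all `x`, that is, the permanent of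
the `0`-`1` matrix of the relation `M`. -/
noncomputable def matchCount {X Y : Type*} (M : X → Y → Prop) : ℕ :=
  Nat.card {σ : X ≃ Y // ∀ x, M x (σ x)}

theorem matchCount_congr {X Y X' Y' : Type*} (f : X ≃ X') (g : Y ≃ Y') {M : X → Y → Prop}
    {M' : X' → Y' → Prop} (h : ∀ x y, M x y ↔ M' (f x) (g y)) :
    matchCount M = matchCount M' := by
  refine Nat.card_congr ((Equiv.equivCongr f g).subtypeEquiv fun σ => ?_)
  constructor
  · intro H x
    simpa using (h _ _).1 (H (f.symm x))
  · intro H x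
    simpa using (h x (σ x)).2 (by simpa using H (f x))

theorem matchCount_flip {X Y : Type*} (M : X → Y → Prop) :
    matchCount (fun y x => M x y) = matchCount M := by
  refine Nat.card_congr (Equiv.subtypeEquiv ⟨Equiv.symm, Equiv.symm, fun _ => rfl, fun _ => rfl⟩
    fun σ => ?_)
  constructor
  · intro H x
    simpa using H (σ.symm x)
  · intro H y
    simpa using H (σ y)

/-- The permanent of a block diagonal matrix is the product of the permanents of the blocks. -/
theorem matchCount_eq_prod_fibers {X Y ι : Type*} [Fintype ι] (α : X → ι) (β : Y → ι)
    {M : X → Y → Prop} (hM : ∀ x y, M x y → β y = α x) :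
    matchCount M = ∏ i, matchCount fun (x : {x // α x = i}) (y : {y // β y = i}) => M x y := by
  unfold matchCount
  rw [← Nat.card_pi]
  refine Nat.card_congr
    { toFun := fun σ i => ⟨σ.1.subtypeEquiv fun x => by rw [hM _ _ (σ.2 x)], fun x => σ.2 x⟩
      invFun := fun τ => ⟨Equiv.ofFiberEquiv fun i => (τ i).1, fun x => by
        have := (τ (α x)).2 ⟨x, rfl⟩
        exact this⟩
      left_inv := fun σ => by
        ext x
        simp [Equiv.ofFiberEquiv]
      right_inv := fun τ => by
        funext i
        apply Subtype.ext
        ext x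
        obtain ⟨x, rfl⟩ := x
        rfl }

/-- If two rows of the matrix agree, then exchanging the images of these rows is an involution
without fixed points. -/
theorem even_matchCount {X Y : Type*} [Finite X] [Finite Y] {M : X → Y → Prop} {x₁ x₂ : X}
    (hne : x₁ ≠ x₂) (h : ∀ y, M x₁ y ↔ M x₂ y) : (matchCount M : ZMod 2) = 0 := by
  classical
  have := Fintype.ofFinite X
  have := Fintype.ofFinite Y
  have hsw : ∀ σ : X ≃ Y, (∀ x, M x (σ x)) →
      ∀ x, M x (((Equiv.swap x₁ x₂).trans σ) x) := by
    intro σ hσ x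
    rcases eq_or_ne x x₁ with rfl | h1
    · simpa using (h _).2 (hσ x₂)
    rcases eq_or_ne x x₂ with rfl | h2
    · simpa using (h _).1 (hσ x₁)
    simpa [Equiv.swap_apply_of_ne_of_ne h1 h2] using hσ x
  unfold matchCount
  rw [Nat.card_eq_fintype_card, ← Finset.card_univ, Finset.card_eq_sum_ones, Nat.cast_sum]
  refine Finset.sum_involution
    (fun σ _ => ⟨(Equiv.swap x₁ x₂).trans σ.1, hsw σ.1 σ.2⟩) ?_ ?_ ?_ ?_
  · intro _ _
    decide
  · intro σ _ _ heq
    have h1 := congrArg (fun τ => τ.1 x₁) heq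
    simp only [Equiv.trans_apply, Equiv.swap_apply_left] at h1
    exact hne (σ.1.injective h1).symm
  · intro _ _
    exact Finset.mem_univ _
  · intro σ _
    apply Subtype.ext
    ext x
    simp

/-- The number of bijections from the disjoint union of `S` and of `b` unconstrained rows to
`{0, …, N-1}` that map each `a ∈ S` to some `y` with `a + y ∈ U`. -/
noncomputable def blockCount (U : Set ℕ) (S : Finset ℕ) (N b : ℕ) : ℕ :=
  matchCount fun (x : S ⊕ Fin b) (y : Fin N) =>
    Sum.elim (fun a : S => (a : ℕ) + y ∈ U) (fun _ => True) x

theorem matchCount_eq_blockCount {X Y : Type*} [Finite X] {U : Set ℕ} {S : Finset ℕ} {N b : ℕ}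
    (p : X → Prop) (f : X → ℕ) (g : Y → ℕ)
    (hfi : ∀ x x', p x → p x' → f x = f x' → x = x') (hfS : ∀ a, a ∈ S ↔ ∃ x, p x ∧ f x = a)
    (hb : Nat.card {x // ¬ p x} = b)
    (hgi : Function.Injective g) (hgN : ∀ a, a < N ↔ ∃ y, g y = a) :
    matchCount (fun (x : X) (y : Y) => p x → f x + g y ∈ U) = blockCount U S N b := by
  classical
  let F₁ : {x // p x} ≃ S := Equiv.ofBijective (fun x => ⟨f x, (hfS _).2 ⟨x, x.2, rfl⟩⟩) <| by
    constructor
    · intro x x' h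
      exact Subtype.ext (hfi _ _ x.2 x'.2 (congrArg Subtype.val h))
    · rintro ⟨a, ha⟩
      obtain ⟨x, hx, rfl⟩ := (hfS a).1 ha
      exact ⟨⟨x, hx⟩, rfl⟩
  let F₂ : {x // ¬ p x} ≃ Fin b := Finite.equivFinOfCardEq hb
  let G : Y ≃ Fin N := Equiv.ofBijective (fun y => ⟨g y, (hgN _).2 ⟨y, rfl⟩⟩) <| by
    constructor
    · intro y y' h
      exact hgi (congrArg Fin.val h)
    · rintro ⟨a, ha⟩
      obtain ⟨y, rfl⟩ := (hgN a).1 ha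
      exact ⟨y, rfl⟩
  refine matchCount_congr ((Equiv.sumCompl p).symm.trans (F₁.sumCongr F₂)) G fun x y => ?_
  by_cases hx : p x
  · simp only [hx, Equiv.trans_apply, Equiv.sumCompl_symm_apply_of_pos, Equiv.sumCongr_apply,
      Sum.map_inl, Sum.elim_inl, forall_const]
    rfl
  · simp [hx]

theorem card_add_eq_of_blockCount_ne_zero {U : Set ℕ} {S : Finset ℕ} {N b : ℕ}
    (h : blockCount U S N b ≠ 0) : S.card + b = N := by
  unfold blockCount matchCount at h
  obtain ⟨⟨σ, -⟩⟩ := (Nat.card_ne_zero.1 h).1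
  simpa using Nat.card_congr σ

theorem even_blockCount {U : Set ℕ} {S : Finset ℕ} {N b : ℕ} (hb : 2 ≤ b) :
    (blockCount U S N b : ZMod 2) = 0 :=
  even_matchCount (x₁ := Sum.inr ⟨0, by omega⟩) (x₂ := Sum.inr ⟨1, by omega⟩) (by simp) (by simp)

theorem ncard_permSet_eq_matchCount (U : Set ℕ) (N l : ℕ) :
    (permSet U N l).ncard =
      matchCount fun x y : Fin N => (x : ℕ) ≠ l → (x : ℕ) + y ∈ U := rfl

theorem blockCount_range (U : Set ℕ) (N : ℕ) :
    blockCount U (Finset.range N) N 0 = (permSet U N N).ncard := by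
  rw [ncard_permSet_eq_matchCount]
  refine (matchCount_eq_blockCount (fun x : Fin N => (x : ℕ) ≠ N) (fun x => x) (fun y : Fin N => (y : ℕ))
    ?_ ?_ ?_ ?_ ?_).symm
  · exact fun x x' _ _ h => Fin.ext h
  · intro a
    rw [Finset.mem_range]
    exact ⟨fun h => ⟨⟨a, h⟩, h.ne, rfl⟩, fun ⟨x, _, h⟩ => h ▸ x.2⟩
  · have : IsEmpty {x : Fin N // ¬ (x : ℕ) ≠ N} := ⟨fun x => x.2 x.1.2.ne⟩
    exact Nat.card_of_isEmpty
  · exact Fin.val_injective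
  · exact fun a => ⟨fun h => ⟨⟨a, h⟩, rfl⟩, fun ⟨x, h⟩ => h ▸ x.2⟩

theorem blockCount_range_erase (U : Set ℕ) {N l : ℕ} (hl : l < N) :
    blockCount U ((Finset.range N).erase l) N 1 = (permSet U N l).ncard := by
  rw [ncard_permSet_eq_matchCount]
  refine (matchCount_eq_blockCount (fun x : Fin N => (x : ℕ) ≠ l) (fun x => x) (fun y : Fin N => (y : ℕ))
    ?_ ?_ ?_ ?_ ?_).symm
  · exact fun x x' _ _ h => Fin.ext h
  · intro a
    rw [Finset.mem_erase, Finset.mem_range]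
    exact ⟨fun h => ⟨⟨a, h.2⟩, h.1, rfl⟩, fun ⟨x, hx, h⟩ => h ▸ ⟨hx, x.2⟩⟩
  · have : Unique {x : Fin N // ¬ (x : ℕ) ≠ l} :=
      { default := ⟨⟨l, hl⟩, by simp⟩
        uniq := fun x => Subtype.ext (Fin.ext (not_not.1 x.2)) }
    exact Nat.card_unique
  · exact Fin.val_injective
  · exact fun a => ⟨fun h => ⟨⟨a, h⟩, rfl⟩, fun ⟨x, h⟩ => h ▸ x.2⟩

theorem blockCount_range_succ (U : Set ℕ) (N : ℕ) :
    blockCount U (Finset.range N) (N + 1) 1 = (permSet U (N + 1) N).ncard := by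
  rw [← blockCount_range_erase U N.lt_succ_self]
  congr 1
  ext a
  simp
  omega

/-- Split the permutations `σ` of `{0, …, N}` according to the value `l` of `σ N`, and invert
the bijection `{0, …, N-1} → {0, …, N} \ {l}` that is left. -/
theorem sum_blockCount_range_succ_erase (U : Set ℕ) (N : ℕ) :
    ∑ l ∈ Finset.range (N + 1), blockCount U ((Finset.range (N + 1)).erase l) N 0 =
      (permSet U (N + 1) N).ncard := by
  classical
  rw [Set.ncard_eq_toFinset_card', Finset.card_eq_sum_card_fiberwise
    (f := fun σ => (σ (Fin.last N) : ℕ)) (t := Finset.range (N + 1))]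
  swap
  · intro σ _
    simp only [Finset.coe_range, Set.mem_Iio]
    exact (σ (Fin.last N)).2
  refine Finset.sum_congr rfl fun l hl => ?_
  rw [Finset.mem_range] at hl
  have h1 : ((permSet U (N + 1) N).toFinset.filter
      fun σ => (σ (Fin.last N) : ℕ) = l).card = matchCount fun x y : Fin (N + 1) =>
        ((y : ℕ) = l ↔ (x : ℕ) = N) ∧ ((x : ℕ) ≠ N → (x : ℕ) + y ∈ U) := by
    unfold matchCount
    rw [← Fintype.card_coe, ← Nat.card_eq_fintype_card]
    refine Nat.card_congr (Equiv.subtypeEquivRight fun σ => ?_)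
    simp only [Finset.mem_filter, Set.mem_toFinset]
    constructor
    · rintro ⟨h1, h2⟩ x
      refine ⟨⟨fun h => ?_, fun h => ?_⟩, h1 x⟩
      · have : x = Fin.last N := σ.injective (Fin.ext (h.trans h2.symm))
        simp [this]
      · have : x = Fin.last N := Fin.ext h
        rw [this, h2]
    · intro h
      exact ⟨fun x => (h x).2, ((h (Fin.last N)).1).2 rfl⟩
  rw [h1, matchCount_eq_prod_fibers (fun x : Fin (N + 1) => decide ((x : ℕ) = N))
    (fun y : Fin (N + 1) => decide ((y : ℕ) = l)) (by
      intro x y h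
      simp [h.1])]
  rw [Fintype.prod_bool]
  have htrue : matchCount (fun (x : {x : Fin (N + 1) // decide ((x : ℕ) = N) = true})
      (y : {y : Fin (N + 1) // decide ((y : ℕ) = l) = true}) =>
        (((y : Fin (N + 1)) : ℕ) = l ↔ ((x : Fin (N + 1)) : ℕ) = N) ∧
        (((x : Fin (N + 1)) : ℕ) ≠ N → ((x : Fin (N + 1)) : ℕ) + (y : Fin (N + 1)) ∈ U)) = 1 := by
    let i₁ : Unique {x : Fin (N + 1) // decide ((x : ℕ) = N) = true} :=
      { default := ⟨Fin.last N, by simp⟩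
        uniq := fun x => Subtype.ext (Fin.ext (by simpa using x.2)) }
    let i₂ : Unique {y : Fin (N + 1) // decide ((y : ℕ) = l) = true} :=
      { default := ⟨⟨l, hl⟩, by simp⟩
        uniq := fun x => Subtype.ext (Fin.ext (by simpa using x.2)) }
    have : Unique {σ : {x : Fin (N + 1) // decide ((x : ℕ) = N) = true} ≃
        {y : Fin (N + 1) // decide ((y : ℕ) = l) = true} // ∀ x,
        (((σ x : Fin (N + 1)) : ℕ) = l ↔ ((x : Fin (N + 1)) : ℕ) = N) ∧
        (((x : Fin (N + 1)) : ℕ) ≠ N →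
          ((x : Fin (N + 1)) : ℕ) + (σ x : Fin (N + 1)) ∈ U)} :=
      { default := ⟨Equiv.ofUnique _ _, fun x => by
          have hx := of_decide_eq_true x.2
          have hy := of_decide_eq_true ((Equiv.ofUnique _ _ : _ ≃
            {y : Fin (N + 1) // decide ((y : ℕ) = l) = true}) x).2
          exact ⟨⟨fun _ => hx, fun _ => hy⟩, fun h => absurd hx h⟩⟩
        uniq := fun σ => Subtype.ext (Equiv.ext fun x => Subsingleton.elim _ _) }
    exact Nat.card_unique
  rw [htrue, one_mul, ← matchCount_flip]
  symm
  refine Eq.trans ?_ (matchCount_eq_blockCount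
    (X := {y : Fin (N + 1) // decide ((y : ℕ) = l) = false})
    (Y := {x : Fin (N + 1) // decide ((x : ℕ) = N) = false}) (U := U)
    (fun _ => True) (fun y => (y : Fin (N + 1))) (fun x => (x : Fin (N + 1)))
    ?_ ?_ ?_ ?_ ?_)
  · refine matchCount_congr (Equiv.refl _) (Equiv.refl _) fun y x => ?_
    have hx := of_decide_eq_false x.2
    have hy := of_decide_eq_false y.2
    simp only [Equiv.refl_apply, iff_false_left hy, hx, ne_eq, not_false_eq_true, forall_const,
      true_and]
    rw [add_comm]
  · exact fun x x' _ _ h => Subtype.ext (Fin.ext h)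
  · intro a
    rw [Finset.mem_erase, Finset.mem_range]
    constructor
    · exact fun h => ⟨⟨⟨a, h.2⟩, by simpa using h.1⟩, trivial, rfl⟩
    · rintro ⟨x, -, rfl⟩
      exact ⟨by simpa using x.2, x.1.2⟩
  · have : IsEmpty {x : {y : Fin (N + 1) // decide ((y : ℕ) = l) = false} // ¬ True} :=
      ⟨fun x => x.2 trivial⟩
    exact Nat.card_of_isEmpty
  · exact fun x x' h => Subtype.ext (Fin.ext h)
  · intro a
    constructor
    · exact fun h => ⟨⟨⟨a, by omega⟩, by simpa using h.ne⟩, rfl⟩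
    · rintro ⟨x, rfl⟩
      have h1 := x.1.2
      have h2 := of_decide_eq_false x.2
      omega

/-! ### Evaluation of the block sums modulo 2 -/

/-- The sum of the block counts over all ways to remove `c` rows from `T`. -/
noncomputable def blockSum (U : Set ℕ) (T : Finset ℕ) (c N b : ℕ) : ℕ :=
  ∑ E ∈ T.powersetCard c, blockCount U (T \ E) N b

theorem blockSum_zero (U : Set ℕ) (T : Finset ℕ) (N b : ℕ) :
    blockSum U T 0 N b = blockCount U T N b := by
  simp [blockSum]

theorem blockSum_one (U : Set ℕ) (T : Finset ℕ) (N b : ℕ) :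
    blockSum U T 1 N b = ∑ a ∈ T, blockCount U (T.erase a) N b := by
  simp [blockSum, Finset.powersetCard_one, Finset.sdiff_singleton_eq_erase]

theorem even_blockSum (U : Set ℕ) (T : Finset ℕ) (c N : ℕ) {b : ℕ} (hb : 2 ≤ b) :
    (blockSum U T c N b : ZMod 2) = 0 := by
  rw [blockSum, Nat.cast_sum]
  exact Finset.sum_eq_zero fun E _ => even_blockCount hb

theorem card_add_eq_of_blockSum_ne_zero {U : Set ℕ} {T : Finset ℕ} {c N b : ℕ}
    (h : blockSum U T c N b ≠ 0) : T.card + b = N + c := by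
  obtain ⟨E, hE, h⟩ := Finset.exists_ne_zero_of_sum_ne_zero h
  rw [Finset.mem_powersetCard] at hE
  have h1 := card_add_eq_of_blockCount_ne_zero h
  have h2 := Finset.card_sdiff_add_card_eq_card hE.1
  omega

/-- The value of `Ψ_G` for a block with `n + p` rows and `n + q` columns; `r` tells that no row
is removed. -/
theorem blockSum_range_eq_PsiG (d : ℕ) (v : ℕ → ℤ) (n b : ℕ) (p q r : Bool)
    (hb : n + p.toNat + b = n + q.toNat + (!r).toNat) :
    (blockSum (setJbar d v) (Finset.range (n + p.toNat)) (!r).toNat (n + q.toNat) b : ZMod 2) =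
      PsiG d v n p q r := by
  cases p <;> cases q <;> cases r <;>
    simp only [Bool.toNat_true, Bool.toNat_false, Bool.not_true, Bool.not_false, add_zero,
      PsiG] at hb ⊢
  · obtain rfl : b = 1 := by omega
    rw [blockSum_one]
    congr 1
    exact Finset.sum_congr rfl fun l hl => blockCount_range_erase _ (Finset.mem_range.1 hl)
  · obtain rfl : b = 0 := by omega
    rw [blockSum_zero, blockCount_range]
    rfl
  · rw [even_blockSum _ _ _ _ (by omega), Nat.cast_zero]
  · obtain rfl : b = 1 := by omega
    rw [blockSum_zero, blockCount_range_succ]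
    rfl
  · obtain rfl : b = 0 := by omega
    rw [blockSum_one, sum_blockCount_range_succ_erase]
    rfl
  · omega
  · obtain rfl : b = 1 := by omega
    rw [blockSum_one]
    congr 1
    exact Finset.sum_congr rfl fun l hl => blockCount_range_erase _ (Finset.mem_range.1 hl)
  · obtain rfl : b = 0 := by omega
    rw [blockSum_zero, blockCount_range]
    rfl

/-- The value of `Ψ_Z` for a block that has lost its last row; `w` tells that the removed row
takes its value in the block, which forces `b ≥ 1`. -/
theorem blockSum_range_eq_PsiZ (d : ℕ) (v : ℕ → ℤ) {n : ℕ} (hn : 2 ≤ n) (b : ℕ) (p q r w : Bool)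
    (hb : n + p.toNat - 1 + b = n + q.toNat + (!r).toNat) (hw : w.toNat ≤ b) :
    (blockSum (setJbar d v) (Finset.range (n + p.toNat - 1)) (!r).toNat (n + q.toNat) b
      : ZMod 2) = PsiZ d v n p q r w := by
  obtain ⟨n, rfl⟩ : ∃ n', n = n' + 1 := ⟨n - 1, by omega⟩
  by_cases hb2 : 2 ≤ b
  · rw [even_blockSum _ _ _ _ hb2]
    cases p <;> cases q <;> cases r <;> cases w <;>
      simp only [Bool.toNat_true, Bool.toNat_false, Bool.not_true, Bool.not_false, add_zero,
        PsiZ, Nat.cast_zero] at hb hw ⊢ <;> omega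
  cases p <;> cases q <;> cases r <;>
    simp only [Bool.toNat_true, Bool.toNat_false, Bool.not_true, Bool.not_false, add_zero,
      Nat.add_sub_cancel] at hb ⊢ <;> try omega
  · obtain rfl : b = 1 := by omega
    rw [blockSum_zero, blockCount_range_succ]
    cases w <;> rfl
  · obtain rfl : b = 1 := by omega
    rw [blockSum_one, Finset.sum_congr rfl fun l hl =>
      blockCount_range_erase _ (Finset.mem_range.1 hl)]
    cases w <;> rfl
  · obtain rfl : b = 0 := by omega
    obtain rfl : w = false := by
      cases w
      · rfl
      · simp at hw
    rw [blockSum_zero, blockCount_range]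
    rfl
  · obtain rfl : b = 1 := by omega
    rw [blockSum_zero, blockCount_range_succ]
    cases w <;> rfl

/-- Exchanging the removed rows `l` and `a` is an involution without fixed points. -/
theorem even_sum_blockSum_erase_one (U : Set ℕ) (T : Finset ℕ) (N b : ℕ) :
    ((∑ l ∈ T, blockSum U (T.erase l) 1 N b : ℕ) : ZMod 2) = 0 := by
  simp only [blockSum_one]
  rw [Finset.sum_sigma', Nat.cast_sum]
  refine Finset.sum_involution (fun x _ => ⟨x.2, x.1⟩) ?_ ?_ ?_ ?_
  · rintro ⟨l, a⟩ -
    rw [Finset.erase_right_comm, ← two_mul]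
    exact zero_mul _
  · rintro ⟨l, a⟩ hx - heq
    simp only [Finset.mem_sigma, Finset.mem_erase] at hx
    simp only [Sigma.mk.injEq] at heq
    exact hx.2.1 heq.1
  · rintro ⟨l, a⟩ hx
    simp only [Finset.mem_sigma, Finset.mem_erase] at hx ⊢
    exact ⟨hx.2.2, hx.2.1.symm, hx.1⟩
  · rintro ⟨l, a⟩ _
    rfl

/-- The value of `Ψ_X`: a block with `n + p` rows loses each of its rows in turn. -/
theorem sum_blockSum_range_erase_eq_PsiX (d : ℕ) (v : ℕ → ℤ) {n : ℕ} (hn : 2 ≤ n) (b : ℕ)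
    (p q r w : Bool)
    (hb : n + p.toNat - 1 + b = n + q.toNat + (!r).toNat) (hw : w.toNat ≤ b) :
    ((∑ l ∈ Finset.range (n + p.toNat),
      blockSum (setJbar d v) ((Finset.range (n + p.toNat)).erase l) (!r).toNat (n + q.toNat) b : ℕ)
      : ZMod 2) = PsiX d v n p q r w := by
  by_cases hb2 : 2 ≤ b
  · rw [Nat.cast_sum, Finset.sum_eq_zero fun l _ => even_blockSum _ _ _ _ hb2]
    cases p <;> cases q <;> cases r <;> cases w <;>
      simp only [Bool.toNat_true, Bool.toNat_false, Bool.not_true, Bool.not_false, add_zero,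
        PsiX, Nat.cast_zero] at hb hw ⊢ <;> omega
  cases r
  · simp only [Bool.not_false, Bool.toNat_true]
    rw [even_sum_blockSum_erase_one]
    cases p <;> cases q <;> cases w <;> simp [PsiX]
  cases p <;> cases q <;>
    simp only [Bool.toNat_true, Bool.toNat_false, Bool.not_true, add_zero, blockSum_zero,
      Nat.add_sub_cancel] at hb ⊢ <;> try omega
  · obtain rfl : b = 1 := by omega
    rw [Finset.sum_congr rfl fun l hl => blockCount_range_erase _ (Finset.mem_range.1 hl)]
    cases w <;> rfl
  · obtain rfl : b = 0 := by omega
    obtain rfl : w = false := by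
      cases w
      · rfl
      · simp at hw
    rw [sum_blockCount_range_succ_erase]
    rfl
  · obtain rfl : b = 1 := by omega
    rw [Finset.sum_congr rfl fun l hl => blockCount_range_erase _ (Finset.mem_range.1 hl)]
    cases w <;> rfl

/-! ### Reduction from `J` to `J̄` -/

theorem mem_setJ_of_mod_mem_setP {d : ℕ} {v : ℕ → ℤ} {z : ℕ} (h : (z + 1) % d ∈ setP d v) :
    z ∈ setJ d v := by
  have h1 : z + 1 = (d * ((z + 1) / d) + (z + 1) % d) := (Nat.div_add_mod _ _).symm
  unfold setJ
  split_ifs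
  · exact Or.inl ⟨(z + 1) / d, 0, _, h, by simpa using h1⟩
  · exact ⟨(z + 1) / d, 0, _, h, by simpa using h1⟩

theorem mul_add_mul_pow_eq_mul_iff {d : ℕ} (hd : 1 ≤ d) {a p k w : ℕ} (h1 : 1 ≤ p) (h2 : p < d) :
    d * (w + 1) = (d * a + p) * d ^ k ↔ ∃ k', k = k' + 1 ∧ w + 1 = (d * a + p) * d ^ k' := by
  constructor
  · intro h
    rcases k with _ | k
    · have h3 := congrArg (· % d) h
      simp [Nat.mod_eq_of_lt h2] at h3
      omega
    · refine ⟨k, rfl, Nat.eq_of_mul_eq_mul_left hd ?_⟩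
      rw [h, pow_succ]
      ring
  · rintro ⟨k, rfl, h⟩
    rw [h, pow_succ]
    ring

/-- Passing from `J` to `J̄` divides `z + 1` by `d`, which lowers the exponent `k` by one. -/
theorem mem_setJ_iff_mem_setJbar {d : ℕ} (hd : 1 ≤ d) {v : ℕ → ℤ} {z w : ℕ}
    (h : z + 1 = d * (w + 1)) : z ∈ setJ d v ↔ w ∈ setJbar d v := by
  have key : ∀ a k p, p ∈ setP d v ∪ setQ d v → (z + 1 = (d * a + p) * d ^ k ↔
      ∃ k', k = k' + 1 ∧ w + 1 = (d * a + p) * d ^ k') := by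
    intro a k p hp
    have hp' : 1 ≤ p ∧ p < d := hp.elim (fun h => ⟨h.1, h.2.1⟩) (fun h => ⟨h.1, h.2.1⟩)
    rw [h, mul_add_mul_pow_eq_mul_iff hd hp'.1 hp'.2]
  unfold setJbar
  by_cases hv : v (d - 1) = -1
  · rw [if_pos hv]
    simp only [setJ, setK, if_pos hv]
    constructor
    · rintro (⟨a, k, p, hp, H⟩ | ⟨a, k, p, hp, H⟩)
      · obtain ⟨k', hk, H⟩ := (key _ _ _ (Or.inl hp)).1 H
        exact Or.inr ⟨a, k - 1, p, hp, by rwa [show 2 * (k - 1) + 1 = k' by omega]⟩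
      · obtain ⟨k', hk, H⟩ := (key _ _ _ (Or.inr hp)).1 H
        exact Or.inl ⟨a, k, p, hp, by rwa [show 2 * k = k' by omega]⟩
    · rintro (⟨a, k, p, hp, H⟩ | ⟨a, k, p, hp, H⟩)
      · exact Or.inr ⟨a, k, p, hp, (key _ _ _ (Or.inr hp)).2 ⟨_, rfl, H⟩⟩
      · exact Or.inl ⟨a, k + 1, p, hp, (key _ _ _ (Or.inl hp)).2 ⟨_, rfl, H⟩⟩
  · rw [if_neg hv]
    simp only [setJ, if_neg hv]
    constructor
    · rintro ⟨a, k, p, hp, H⟩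
      obtain ⟨k', hk, H⟩ := (key _ _ _ (Or.inl hp)).1 H
      exact ⟨a, k', p, hp, H⟩
    · rintro ⟨a, k, p, hp, H⟩
      exact ⟨a, k + 1, p, hp, (key _ _ _ (Or.inl hp)).2 ⟨k, rfl, H⟩⟩

/-- The permutations of the type given by `s` and (if `l < m`) `sd`, whose columns `(x, y)` with
`x ∈ A_i`, `y ∈ A_{d-i-1}`, `x ≠ l`, satisfy `⌊x/d⌋ + ⌊y/d⌋ ∈ U`. -/
def typedPerms (d m : ℕ) (s : Fin d → Fin d) (sd : Fin d) (U : Set ℕ) (l : ℕ) :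
    Set (Equiv.Perm (Fin m)) :=
  {σ | HasForm d m l s σ ∧ (l < m → HasSpecific d m l sd σ) ∧
    ∀ x : Fin m, (x : ℕ) ≠ l → (σ x : ℕ) % d = d - (x : ℕ) % d - 1 →
      (x : ℕ) / d + (σ x : ℕ) / d ∈ U}

theorem mod_eq_or_of_hasForm {d m l : ℕ} (hd : 1 ≤ d) {s : Fin d → Fin d}
    {σ : Equiv.Perm (Fin m)} (h : HasForm d m l s σ) {x : Fin m} (hx : (x : ℕ) ≠ l) :
    (σ x : ℕ) % d = s ⟨x % d, Nat.mod_lt _ hd⟩ ∨ (σ x : ℕ) % d = d - (x : ℕ) % d - 1 := by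
  obtain ⟨y, _, _, hys, hy⟩ := h ⟨x % d, Nat.mod_lt _ hd⟩
  rcases eq_or_ne x y with rfl | hxy
  · exact Or.inl hys
  · exact Or.inr (hy x hxy hx rfl)

theorem hasForm_and_mem_permSet'_iff {d m l : ℕ} (hd : 1 ≤ d) {v : ℕ → ℤ} {s : Fin d → Fin d}
    (hs : LetterCond d v s) {σ : Equiv.Perm (Fin m)} (h : HasForm d m l s σ) :
    σ ∈ permSet' d v m l ↔ ∀ x : Fin m, (x : ℕ) ≠ l → (σ x : ℕ) % d = d - (x : ℕ) % d - 1 →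
      (x : ℕ) / d + (σ x : ℕ) / d ∈ setJbar d v := by
  have hJ : ∀ x : Fin m, (σ x : ℕ) % d = d - (x : ℕ) % d - 1 →
      ((x : ℕ) + σ x ∈ setJ d v ↔ (x : ℕ) / d + (σ x : ℕ) / d ∈ setJbar d v) := by
    intro x hx
    refine mem_setJ_iff_mem_setJbar hd ?_
    have h1 := Nat.div_add_mod (x : ℕ) d
    have h2 := Nat.div_add_mod (σ x : ℕ) d
    have h3 := Nat.mod_lt (x : ℕ) hd
    rw [mul_add, mul_add]
    omega
  constructor
  · exact fun H x hx hx' => (hJ x hx').1 (H.1 x hx)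
  · intro H
    refine ⟨fun x hx => ?_, fun i hi => ?_⟩
    · by_cases hx' : (σ x : ℕ) % d = d - (x : ℕ) % d - 1
      · exact (hJ x hx').2 (H x hx hx')
      have hsx := (mod_eq_or_of_hasForm hd h hx).resolve_right hx'
      apply mem_setJ_of_mod_mem_setP
      have h1 := hs ⟨x % d, Nat.mod_lt _ hd⟩
      rw [← hsx] at h1
      have h2 : ((x : ℕ) % d + (σ x : ℕ) % d + 1) % d = ((x : ℕ) + σ x + 1) % d := by
        simp [Nat.add_mod]
      rw [← h2]
      refine h1.resolve_right fun h0 => hx' ?_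
      have h3 := Nat.mod_lt (x : ℕ) hd
      have h4 := Nat.mod_lt (σ x : ℕ) hd
      obtain ⟨c, hc⟩ := Nat.dvd_of_mod_eq_zero h0
      simp only at hc
      obtain rfl : c = 1 := by
        rcases c with _ | _ | c
        · omega
        · rfl
        · rw [mul_add, mul_add] at hc
          omega
      omega
    · obtain ⟨y, _, _, hys, hy⟩ := h ⟨i, hi⟩
      refine (Set.ncard_le_ncard (t := {y}) (fun x hx => ?_) (Set.finite_singleton _)).trans
        (Set.ncard_singleton _).le
      by_contra hxy
      have h1 := hy x hxy hx.1 hx.2.1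
      have h2 := hx.2.2.1
      have h3 : (x : ℕ) % d + (σ x : ℕ) % d + 1 = d := by
        rw [h1, hx.2.1]
        simp only
        omega
      rw [h3, Nat.mod_self] at h2
      omega

theorem setPY_eq_typedPerms {d m : ℕ} (hd : 1 ≤ d) {v : ℕ → ℤ} {s : Fin d → Fin d} (sd : Fin d)
    (hs : LetterCond d v s) : setPY d v m s = typedPerms d m s sd (setJbar d v) m := by
  ext σ
  constructor
  · rintro ⟨h1, h2⟩
    exact ⟨h2, fun h => absurd h (lt_irrefl _), (hasForm_and_mem_permSet'_iff hd hs h2).1 h1⟩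
  · rintro ⟨h1, -, h2⟩
    exact ⟨(hasForm_and_mem_permSet'_iff hd hs h1).2 h2, h1⟩

theorem permSetType_eq_typedPerms {d m l : ℕ} (hd : 1 ≤ d) {v : ℕ → ℤ} {s : Fin d → Fin d}
    (sd : Fin d) (hs : LetterCond d v s) (hl : l < m) :
    permSetType d v m l s sd = typedPerms d m s sd (setJbar d v) l := by
  ext σ
  constructor
  · rintro ⟨h1, h2, h3⟩
    exact ⟨h2, fun _ => h3, (hasForm_and_mem_permSet'_iff hd hs h2).1 h1⟩
  · rintro ⟨h1, h2, h3⟩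
    exact ⟨(hasForm_and_mem_permSet'_iff hd hs h1).2 h3, h1, h2 hl⟩

/-! ### Block structure for given exceptional places -/

theorem mul_add_lt_mul_add_iff {d r h : ℕ} (hr : r < d) (hh : h < d) (a n : ℕ) :
    d * a + r < d * n + h ↔ a < n + (decide (r < h)).toNat := by
  have mono : ∀ a b, a + 1 ≤ b → d * a + d ≤ d * b := fun a b hab => by
    have := Nat.mul_le_mul_left d hab
    rwa [mul_add, mul_one] at this
  rcases lt_trichotomy a n with han | rfl | han
  · have := mono _ _ han
    exact ⟨fun _ => by omega, fun _ => by omega⟩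
  · by_cases hrh : r < h <;> simp [hrh]
  · have := mono _ _ han
    have : (decide (r < h)).toNat ≤ 1 := Bool.toNat_le _
    exact ⟨fun _ => by omega, fun _ => by omega⟩

/-- The residue class of `x` modulo `d`. -/
def residue {d : ℕ} (hd : 1 ≤ d) (x : ℕ) : Fin d := ⟨x % d, Nat.mod_lt _ hd⟩

/-- The rows of the block `i`: the quotients `⌊x/d⌋` for `x ∈ A_i`, `x < m`, `x ≠ l`. -/
def rows (d m l i : ℕ) : Finset ℕ :=
  (Finset.range m).filter fun a => d * a + i < m ∧ d * a + i ≠ l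

theorem mem_rows {d m l i : ℕ} (hd : 1 ≤ d) (hi : i < d) {a : ℕ} :
    a ∈ rows d m l i ↔ ∃ x : Fin m, (x : ℕ) ≠ l ∧ (x : ℕ) % d = i ∧ (x : ℕ) / d = a := by
  simp only [rows, Finset.mem_filter, Finset.mem_range]
  constructor
  · rintro ⟨-, h1, h2⟩
    refine ⟨⟨d * a + i, h1⟩, h2, ?_, ?_⟩
    · simp [Nat.add_mod, Nat.mod_eq_of_lt hi]
    · simp [Nat.mul_add_div hd, Nat.div_eq_of_lt hi]
  · rintro ⟨x, h1, rfl, rfl⟩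
    rw [Nat.div_add_mod]
    exact ⟨(Nat.div_le_self _ _).trans_lt x.2, x.2, h1⟩

theorem eq_of_mod_eq_of_div_eq {d x y : ℕ} (h1 : x % d = y % d) (h2 : x / d = y / d) : x = y := by
  rw [← Nat.div_add_mod x d, h1, h2, Nat.div_add_mod]

/-- The number of columns of the block `i` whose bottom letter `s_i` is not `a_{d-i-1}`. -/
def defect {d : ℕ} (s : Fin d → Fin d) (i : Fin d) : ℕ := (!eta2 s i).toNat

theorem defect_eq_zero_iff {d : ℕ} {s : Fin d → Fin d} {i : Fin d} :
    defect s i = 0 ↔ (s i : ℕ) = d - i - 1 := by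
  by_cases h : (s i : ℕ) = d - i - 1 <;> simp [defect, eta2, h]

theorem defect_eq_zero_or_one {d : ℕ} (s : Fin d → Fin d) (i : Fin d) :
    defect s i = 0 ∨ defect s i = 1 := by
  unfold defect
  cases eta2 s i <;> simp

/-- The number of values in `A_{d-i-1}` that are taken at the exceptional places of a permutation
of the type given by `s` and `sd`: at `l`, or at a place whose bottom letter is an
`s_j ≠ a_{d-j-1}`. -/
def freeRows {d : ℕ} (m l : ℕ) (s : Fin d → Fin d) (sd i : Fin d) : ℕ :=
  (∑ j, if (s j).rev = i then defect s j else 0) + if l < m ∧ sd.rev = i then 1 else 0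

/-- The place `x` is exceptional: it is `l`, or it is one of the places given by `e`. -/
def IsFree {d : ℕ} (hd : 1 ≤ d) (l : ℕ) (e : Fin d → Finset ℕ) (x : ℕ) : Prop :=
  x = l ∨ x / d ∈ e (residue hd x)

/-- The block `i` for which the value at `x` has to lie in `A_{d-i-1}`. -/
def targetBlock {d : ℕ} (hd : 1 ≤ d) (l : ℕ) (s : Fin d → Fin d) (sd : Fin d)
    (e : Fin d → Finset ℕ) (x : ℕ) : Fin d :=
  if x = l then sd.rev
  else if x / d ∈ e (residue hd x) then (s (residue hd x)).rev else residue hd x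

/-- The relation between places and values for the permutations with exceptional places `e`. -/
def columnRel {d : ℕ} (hd : 1 ≤ d) (m l : ℕ) (s : Fin d → Fin d) (sd : Fin d) (U : Set ℕ)
    (e : Fin d → Finset ℕ) (x y : Fin m) : Prop :=
  (residue hd y).rev = targetBlock hd l s sd e x ∧
    (¬ IsFree hd l e x → (x : ℕ) / d + (y : ℕ) / d ∈ U)

theorem rev_residue_eq_rev_iff {d : ℕ} (hd : 1 ≤ d) (y : ℕ) (j : Fin d) :
    (residue hd y).rev = j.rev ↔ y % d = j := by
  rw [Fin.rev_inj, Fin.ext_iff]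
  rfl

theorem rev_residue_eq_iff {d : ℕ} (hd : 1 ≤ d) (y : ℕ) (j : Fin d) :
    (residue hd y).rev = j ↔ y % d = d - j - 1 := by
  rw [← Fin.rev_inj, Fin.rev_rev, Fin.ext_iff, Fin.val_rev, Nat.sub_sub]
  rfl

/-- The exceptional places of `σ` in the block `i`, other than `l`. -/
def exceptions {d m : ℕ} (l : ℕ) (σ : Equiv.Perm (Fin m)) (i : Fin d) : Finset ℕ :=
  (rows d m l i).filter fun a => ∃ x : Fin m, (x : ℕ) = d * a + i ∧ (σ x : ℕ) % d ≠ d - i - 1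

theorem div_mem_exceptions_iff {d m l : ℕ} (hd : 1 ≤ d) {σ : Equiv.Perm (Fin m)} {x : Fin m}
    (hx : (x : ℕ) ≠ l) : (x : ℕ) / d ∈ exceptions l σ (residue hd x) ↔
      (σ x : ℕ) % d ≠ d - (x : ℕ) % d - 1 := by
  have hxr : (x : ℕ) / d ∈ rows d m l (residue hd x) :=
    (mem_rows hd (residue hd x).2).2 ⟨x, hx, rfl, rfl⟩
  simp only [exceptions, Finset.mem_filter, hxr, true_and]
  constructor
  · rintro ⟨y, hy, h⟩
    obtain rfl : y = x := Fin.ext (hy.trans (Nat.div_add_mod _ _))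
    exact h
  · exact fun h => ⟨x, (Nat.div_add_mod _ _).symm, h⟩

theorem exceptions_mem_piFinset {d m l : ℕ} (hd : 1 ≤ d) {s : Fin d → Fin d}
    {σ : Equiv.Perm (Fin m)} (h : HasForm d m l s σ) :
    exceptions l σ ∈ Fintype.piFinset fun i : Fin d =>
      (rows d m l i).powersetCard (defect s i) := by
  rw [Fintype.mem_piFinset]
  intro i
  rw [Finset.mem_powersetCard]
  refine ⟨Finset.filter_subset _ _, ?_⟩
  obtain ⟨x, hxl, hxi, hxs, hx⟩ := h i
  have hmem : ∀ a, a ∈ exceptions l σ i ↔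
      ∃ y : Fin m, (y : ℕ) ≠ l ∧ (y : ℕ) % d = i ∧ (y : ℕ) / d = a ∧
        (σ y : ℕ) % d ≠ d - i - 1 := by
    intro a
    constructor
    · intro ha
      obtain ⟨y, h1, h2, rfl⟩ := (mem_rows hd i.2).1 (Finset.mem_filter.1 ha).1
      have hy : residue hd y = i := Fin.ext h2
      rw [← hy, div_mem_exceptions_iff hd h1, h2] at ha
      exact ⟨y, h1, h2, rfl, ha⟩
    · rintro ⟨y, h1, h2, rfl, h3⟩
      have hy : residue hd y = i := Fin.ext h2
      rw [← hy, div_mem_exceptions_iff hd h1, h2]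
      exact h3
  rcases defect_eq_zero_or_one s i with h0 | h1
  · rw [h0, Finset.card_eq_zero, Finset.eq_empty_iff_forall_notMem]
    intro a ha
    obtain ⟨y, h1, h2, rfl, h3⟩ := (hmem a).1 ha
    rcases eq_or_ne y x with rfl | hyx
    · exact h3 (hxs.trans (defect_eq_zero_iff.1 h0))
    · exact h3 (hx y hyx h1 h2)
  · rw [h1, Finset.card_eq_one]
    refine ⟨x / d, ?_⟩
    ext a
    rw [hmem, Finset.mem_singleton]
    constructor
    · rintro ⟨y, h1, h2, rfl, h3⟩
      rcases eq_or_ne y x with rfl | hyx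
      · rfl
      · exact absurd (hx y hyx h1 h2) h3
    · rintro rfl
      refine ⟨x, hxl, hxi, rfl, ?_⟩
      rw [hxs]
      intro h0
      rw [defect_eq_zero_iff.2 h0] at h1
      omega

theorem forall_columnRel_iff {d m l : ℕ} (hd : 1 ≤ d) {s : Fin d → Fin d} {sd : Fin d}
    {U : Set ℕ} {e : Fin d → Finset ℕ} (hr : ∀ i : Fin d, (rows d m l i).Nonempty)
    (he : e ∈ Fintype.piFinset fun i : Fin d => (rows d m l i).powersetCard (defect s i))
    (σ : Equiv.Perm (Fin m)) :
    (σ ∈ typedPerms d m s sd U l ∧ exceptions l σ = e) ↔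
      ∀ x, columnRel hd m l s sd U e x (σ x) := by
  rw [Fintype.mem_piFinset] at he
  simp only [Finset.mem_powersetCard] at he
  have hdef : ∀ i a, a ∈ e i → defect s i = 1 := by
    intro i a ha
    rcases defect_eq_zero_or_one s i with h | h
    · have := (he i).2
      rw [h, Finset.card_eq_zero] at this
      simp [this] at ha
    · exact h
  constructor
  · rintro ⟨⟨h1, h2, h3⟩, rfl⟩ x
    by_cases hxl : (x : ℕ) = l
    · obtain ⟨y, hy, hys⟩ := h2 (hxl ▸ x.2)
      obtain rfl : y = x := Fin.ext (hy.trans hxl.symm)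
      refine ⟨?_, fun h => absurd (Or.inl hxl) h⟩
      rw [targetBlock, if_pos hxl, rev_residue_eq_rev_iff]
      exact hys
    · by_cases hxe : (x : ℕ) / d ∈ exceptions l σ (residue hd x)
      · refine ⟨?_, fun h => absurd (Or.inr hxe) h⟩
        rw [targetBlock, if_neg hxl, if_pos hxe, rev_residue_eq_rev_iff]
        rw [div_mem_exceptions_iff hd hxl] at hxe
        exact (mod_eq_or_of_hasForm hd h1 hxl).resolve_right hxe
      · have hxe' := hxe
        rw [div_mem_exceptions_iff hd hxl, not_not] at hxe'
        refine ⟨?_, fun _ => h3 x hxl hxe'⟩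
        rw [targetBlock, if_neg hxl, if_neg hxe, rev_residue_eq_iff]
        exact hxe'
  · intro H
    have hin : ∀ x : Fin m, (x : ℕ) ≠ l → (x : ℕ) / d ∈ e (residue hd x) →
        (σ x : ℕ) % d = s (residue hd x) := by
      intro x hxl hxe
      have := (H x).1
      rwa [targetBlock, if_neg hxl, if_pos hxe, rev_residue_eq_rev_iff] at this
    have hin' : ∀ x : Fin m, (x : ℕ) ≠ l → (x : ℕ) / d ∈ e (residue hd x) →
        (σ x : ℕ) % d ≠ d - (x : ℕ) % d - 1 := by
      intro x hxl hxe h0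
      rw [hin x hxl hxe] at h0
      have h1 := hdef _ _ hxe
      rw [defect_eq_zero_iff.2 h0] at h1
      omega
    have hout : ∀ x : Fin m, (x : ℕ) ≠ l → (x : ℕ) / d ∉ e (residue hd x) →
        (σ x : ℕ) % d = d - (x : ℕ) % d - 1 := by
      intro x hxl hxe
      have := (H x).1
      rwa [targetBlock, if_neg hxl, if_neg hxe, rev_residue_eq_iff] at this
    refine ⟨⟨fun i => ?_, fun hl => ⟨⟨l, hl⟩, rfl, ?_⟩, fun x hxl hx => (H x).2 ?_⟩, ?_⟩
    · rcases defect_eq_zero_or_one s i with h0 | h1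
      · have he0 := (he i).2
        rw [h0, Finset.card_eq_zero] at he0
        have hall : ∀ y : Fin m, (y : ℕ) ≠ l → (y : ℕ) % d = i → (σ y : ℕ) % d = d - i - 1 := by
          intro y hyl hyi
          have hy : residue hd y = i := Fin.ext hyi
          rw [hout y hyl (by simp [hy, he0]), hyi]
        obtain ⟨a, ha⟩ := hr i
        obtain ⟨x, hxl, hxi, -⟩ := (mem_rows hd i.2).1 ha
        exact ⟨x, hxl, hxi, (hall x hxl hxi).trans (defect_eq_zero_iff.1 h0).symm,
          fun y _ => hall y⟩
      · have he1 := (he i).2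
        rw [h1, Finset.card_eq_one] at he1
        obtain ⟨a, ha⟩ := he1
        obtain ⟨x, hxl, hxi, hxa⟩ :=
          (mem_rows hd i.2).1 ((he i).1 (ha ▸ Finset.mem_singleton_self a))
        have hx : residue hd x = i := Fin.ext hxi
        refine ⟨x, hxl, hxi, ?_, fun y hyx hyl hyi => ?_⟩
        · rw [hin x hxl (by simp [hx, ha, hxa]), hx]
        · have hy : residue hd y = i := Fin.ext hyi
          rw [hout y hyl ?_, hyi]
          rw [hy, ha, Finset.mem_singleton]
          exact fun hya => hyx (Fin.ext (eq_of_mod_eq_of_div_eq (hyi.trans hxi.symm)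
            (hya.trans hxa.symm)))
    · have := (H ⟨l, hl⟩).1
      rwa [targetBlock, if_pos rfl, rev_residue_eq_rev_iff] at this
    · rintro (h | h)
      · exact hxl h
      · exact hin' x hxl h hx
    · funext i
      ext a
      constructor
      · intro ha
        obtain ⟨x, hxl, hxi, rfl⟩ := (mem_rows hd i.2).1 (Finset.mem_filter.1 ha).1
        obtain rfl : residue hd x = i := Fin.ext hxi
        rw [div_mem_exceptions_iff hd hxl] at ha
        exact not_not.1 fun h => ha (hout x hxl h)
      · intro ha
        obtain ⟨x, hxl, hxi, rfl⟩ := (mem_rows hd i.2).1 ((he i).1 ha)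
        obtain rfl : residue hd x = i := Fin.ext hxi
        rw [div_mem_exceptions_iff hd hxl]
        exact hin' x hxl ha

theorem ncard_typedPerms_eq_sum {d m l : ℕ} (hd : 1 ≤ d) (s : Fin d → Fin d) (sd : Fin d)
    (U : Set ℕ) (hr : ∀ i : Fin d, (rows d m l i).Nonempty) :
    (typedPerms d m s sd U l).ncard =
      ∑ e ∈ Fintype.piFinset fun i : Fin d => (rows d m l i).powersetCard (defect s i),
        matchCount (columnRel hd m l s sd U e) := by
  classical
  rw [Set.ncard_eq_toFinset_card', Finset.card_eq_sum_card_fiberwise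
    (f := fun σ => exceptions (d := d) l σ) (t := Fintype.piFinset fun i : Fin d =>
      (rows d m l i).powersetCard (defect s i))]
  swap
  · intro σ hσ
    rw [Finset.mem_coe, Set.mem_toFinset] at hσ
    exact exceptions_mem_piFinset hd hσ.1
  refine Finset.sum_congr rfl fun e he => ?_
  unfold matchCount
  rw [← Fintype.card_coe, ← Nat.card_eq_fintype_card]
  refine Nat.card_congr (Equiv.subtypeEquivRight fun σ => ?_)
  rw [Finset.mem_filter, Set.mem_toFinset]
  exact forall_columnRel_iff hd hr he σ

/-! ### The product over the blocks -/

theorem card_isFree_targetBlock {d m l : ℕ} (hd : 1 ≤ d) {s : Fin d → Fin d} {sd : Fin d}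
    {e : Fin d → Finset ℕ}
    (he : e ∈ Fintype.piFinset fun i : Fin d => (rows d m l i).powersetCard (defect s i))
    (i : Fin d) :
    Nat.card {x : Fin m // IsFree hd l e x ∧ targetBlock hd l s sd e x = i} =
      freeRows m l s sd i := by
  classical
  rw [Fintype.mem_piFinset] at he
  simp only [Finset.mem_powersetCard] at he
  rw [Nat.card_eq_fintype_card, Fintype.card_subtype, freeRows,
    ← Finset.card_filter_add_card_filter_not (fun x : Fin m => (x : ℕ) ≠ l)]
  congr 1
  · rw [Finset.card_eq_sum_card_fiberwise (f := fun x : Fin m => residue hd x)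
      (t := Finset.univ) (by simp)]
    refine Finset.sum_congr rfl fun j _ => ?_
    by_cases hj : (s j).rev = i
    · rw [if_pos hj, ← (he j).2]
      refine Finset.card_bij (fun x _ => (x : ℕ) / d) ?_ ?_ ?_
      · intro x hx
        simp only [Finset.mem_filter, Finset.mem_univ, true_and] at hx
        obtain ⟨⟨⟨h1, -⟩, h2⟩, rfl⟩ := hx
        exact h1.resolve_left h2
      · intro x hx y hy hxy
        simp only [Finset.mem_filter, Finset.mem_univ, true_and] at hx hy
        exact Fin.ext (eq_of_mod_eq_of_div_eq
          (congrArg Fin.val (hx.2.trans hy.2.symm)) hxy)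
      · intro a ha
        obtain ⟨x, hxl, hxj, rfl⟩ := (mem_rows hd j.2).1 ((he j).1 ha)
        obtain rfl : residue hd x = j := Fin.ext hxj
        refine ⟨x, ?_, rfl⟩
        simp only [Finset.mem_filter, Finset.mem_univ, true_and]
        refine ⟨⟨⟨Or.inr ha, ?_⟩, hxl⟩, trivial⟩
        rw [targetBlock, if_neg hxl, if_pos ha, hj]
    · rw [if_neg hj, Finset.card_eq_zero, Finset.eq_empty_iff_forall_notMem]
      intro x hx
      simp only [Finset.mem_filter, Finset.mem_univ, true_and] at hx
      obtain ⟨⟨⟨h1, h2⟩, h3⟩, rfl⟩ := hx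
      rw [targetBlock, if_neg h3, if_pos (h1.resolve_left h3)] at h2
      exact hj h2
  · split_ifs with h
    · rw [Finset.card_eq_one]
      refine ⟨⟨l, h.1⟩, ?_⟩
      ext x
      simp only [Finset.mem_filter, Finset.mem_univ, true_and, not_not, Finset.mem_singleton,
        Fin.ext_iff]
      refine ⟨fun hx => hx.2, fun hx => ⟨⟨Or.inl hx, ?_⟩, hx⟩⟩
      rw [targetBlock, if_pos hx, h.2]
    · rw [Finset.card_eq_zero, Finset.eq_empty_iff_forall_notMem]
      intro x hx
      simp only [Finset.mem_filter, Finset.mem_univ, true_and, not_not] at hx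
      obtain ⟨⟨-, h2⟩, h3⟩ := hx
      rw [targetBlock, if_pos h3] at h2
      exact h ⟨h3 ▸ x.2, h2⟩

theorem matchCount_columnRel {d n h m l : ℕ} (hd : 1 ≤ d) (hh : h < d) (hm : m = d * n + h)
    {s : Fin d → Fin d} {sd : Fin d} (U : Set ℕ) {e : Fin d → Finset ℕ}
    (he : e ∈ Fintype.piFinset fun i : Fin d => (rows d m l i).powersetCard (defect s i)) :
    matchCount (columnRel hd m l s sd U e) =
      ∏ i : Fin d, blockCount U (rows d m l i \ e i) (n + (eta1 h i).toNat)
        (freeRows m l s sd i) := by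
  rw [matchCount_eq_prod_fibers (fun x : Fin m => targetBlock hd l s sd e x)
    (fun y : Fin m => (residue hd y).rev) (fun x y hxy => hxy.1)]
  refine Finset.prod_congr rfl fun i _ => ?_
  -- A place of the block that is not exceptional lies in `A_i`.
  have hnf : ∀ x : ℕ, targetBlock hd l s sd e x = i → ¬ IsFree hd l e x → residue hd x = i := by
    intro x hx hf
    rw [IsFree, not_or] at hf
    rwa [targetBlock, if_neg hf.1, if_neg hf.2] at hx
  refine Eq.trans ?_ (matchCount_eq_blockCount
    (X := {x : Fin m // targetBlock hd l s sd e x = i})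
    (Y := {y : Fin m // (residue hd y).rev = i}) (U := U)
    (fun x => ¬ IsFree hd l e (x : Fin m)) (fun x => ((x : Fin m) : ℕ) / d)
    (fun y => ((y : Fin m) : ℕ) / d) ?_ ?_ ?_ ?_ ?_)
  · refine matchCount_congr (Equiv.refl _) (Equiv.refl _) fun x y => ?_
    simp only [columnRel, Equiv.refl_apply]
    rw [x.2, y.2]
    simp
  · intro x x' hx hx' hxx
    exact Subtype.ext (Fin.ext (eq_of_mod_eq_of_div_eq (congrArg Fin.val
      ((hnf _ x.2 hx).trans (hnf _ x'.2 hx').symm)) hxx))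
  · intro a
    rw [Finset.mem_sdiff]
    constructor
    · rintro ⟨ha, hae⟩
      obtain ⟨x, hxl, hxi, rfl⟩ := (mem_rows hd i.2).1 ha
      obtain rfl : residue hd x = i := Fin.ext hxi
      refine ⟨⟨x, ?_⟩, ?_, rfl⟩
      · rw [targetBlock, if_neg hxl, if_neg hae]
      · exact fun h => h.elim hxl hae
    · rintro ⟨x, hx, rfl⟩
      have hxi := hnf _ x.2 hx
      rw [IsFree, not_or, hxi] at hx
      exact ⟨(mem_rows hd i.2).2 ⟨x, hx.1, congrArg Fin.val hxi, rfl⟩, hx.2⟩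
  · rw [← card_isFree_targetBlock hd he i]
    refine Nat.card_congr ((Equiv.subtypeSubtypeEquivSubtypeInter
      (fun x : Fin m => targetBlock hd l s sd e x = i)
      (fun x : Fin m => ¬¬ IsFree hd l e x)).trans
      (Equiv.subtypeEquivRight fun x => ?_))
    rw [not_not, and_comm]
  · intro y y' hyy
    exact Subtype.ext (Fin.ext (eq_of_mod_eq_of_div_eq (congrArg Fin.val
      (Fin.rev_injective (y.2.trans y'.2.symm))) hyy))
  · intro a
    have hlt : d * a + i.rev < m ↔ a < n + (eta1 h i).toNat := by
      rw [hm, mul_add_lt_mul_add_iff i.rev.2 hh]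
      have : decide ((i.rev : ℕ) < h) = eta1 h i := by
        have := i.2
        rw [eta1, decide_eq_decide, Fin.val_rev]
        omega
      rw [this]
    rw [← hlt]
    constructor
    · intro ha
      refine ⟨⟨⟨_, ha⟩, ?_⟩, ?_⟩
      · rw [← Fin.rev_inj, Fin.rev_rev]
        apply Fin.ext
        simp [residue, Nat.add_mod]
      · simp only
        rw [Nat.mul_add_div hd, Nat.div_eq_of_lt i.rev.2, add_zero]
    · rintro ⟨⟨y, hy⟩, rfl⟩
      rw [← Fin.rev_inj, Fin.rev_rev] at hy
      have hy' : (y : ℕ) % d = i.rev := congrArg Fin.val hy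
      simp only
      rw [← hy', Nat.div_add_mod]
      exact y.2

/-- The permutations of a given type are counted by a product over the blocks. -/
theorem ncard_typedPerms_eq_prod {d n h m l : ℕ} (hd : 1 ≤ d) (hh : h < d) (hm : m = d * n + h)
    (s : Fin d → Fin d) (sd : Fin d) (U : Set ℕ) (hr : ∀ i : Fin d, (rows d m l i).Nonempty) :
    (typedPerms d m s sd U l).ncard =
      ∏ i : Fin d, blockSum U (rows d m l i) (defect s i) (n + (eta1 h i).toNat)
        (freeRows m l s sd i) := by
  simp only [blockSum]
  rw [ncard_typedPerms_eq_sum hd s sd U hr, Finset.prod_univ_sum]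
  exact Finset.sum_congr rfl fun e he => matchCount_columnRel hd hh hm U he

/-- A possible type balances rows and columns in each block: take `U` to be the set of all
natural numbers. -/
theorem card_rows_add_freeRows {d n h m l : ℕ} (hd : 1 ≤ d) (hh : h < d) (hm : m = d * n + h)
    {s : Fin d → Fin d} {sd : Fin d} (hr : ∀ i : Fin d, (rows d m l i).Nonempty)
    {σ : Equiv.Perm (Fin m)} (h1 : HasForm d m l s σ) (h2 : l < m → HasSpecific d m l sd σ)
    (i : Fin d) :
    (rows d m l i).card + freeRows m l s sd i = n + (eta1 h i).toNat + defect s i := by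
  have hne : (typedPerms d m s sd Set.univ l).ncard ≠ 0 := by
    exact Set.ncard_ne_zero_of_mem (a := σ) ⟨h1, h2, fun _ _ _ => trivial⟩ (Set.toFinite _)
  rw [ncard_typedPerms_eq_prod hd hh hm s sd _ hr, Finset.prod_ne_zero_iff] at hne
  exact card_add_eq_of_blockSum_ne_zero (hne i (Finset.mem_univ i))

theorem rows_eq_range {d n h m l : ℕ} (hh : h < d) (hm : m = d * n + h) (i : Fin d)
    (hl : l < m → l % d ≠ i) : rows d m l i = Finset.range (n + (eta0 h i).toNat) := by
  ext a
  have hlt : d * a + i < m ↔ a < n + (eta0 h i).toNat := by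
    rw [hm, mul_add_lt_mul_add_iff i.2 hh]
    rfl
  rw [rows, Finset.mem_filter, Finset.mem_range, Finset.mem_range, ← hlt]
  refine ⟨fun h => h.2.1, fun h => ⟨?_, h, fun hal => hl (hal ▸ h) ?_⟩⟩
  · have := Nat.le_mul_of_pos_left a i.pos
    omega
  · rw [← hal, Nat.mul_add_mod, Nat.mod_eq_of_lt i.2]

theorem rows_eq_range_erase {d n h m l : ℕ} (hh : h < d) (hm : m = d * n + h) (i : Fin d)
    (hl : l % d = i) :
    rows d m l i = (Finset.range (n + (eta0 h i).toNat)).erase (l / d) := by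
  ext a
  have hlt : d * a + i < m ↔ a < n + (eta0 h i).toNat := by
    rw [hm, mul_add_lt_mul_add_iff i.2 hh]
    rfl
  rw [rows, Finset.mem_filter, Finset.mem_range, Finset.mem_erase, Finset.mem_range, ← hlt]
  have hal : d * a + i = l ↔ a = l / d := by
    constructor
    · rintro rfl
      rw [Nat.mul_add_div i.pos, Nat.div_eq_of_lt i.2, add_zero]
    · rintro rfl
      rw [← hl, Nat.div_add_mod]
  rw [ne_eq, hal]
  refine ⟨fun h => ⟨h.2.2, h.2.1⟩, fun h => ⟨?_, h.2, h.1⟩⟩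
  have := Nat.le_mul_of_pos_left a i.pos
  omega

theorem rows_nonempty {d n h m l : ℕ} (hn : 2 ≤ n) (hh : h < d) (hm : m = d * n + h)
    (i : Fin d) : (rows d m l i).Nonempty := by
  rw [← Finset.card_pos]
  by_cases hl : l % d = i
  · rw [rows_eq_range_erase hh hm i hl]
    have := Finset.pred_card_le_card_erase (s := Finset.range (n + (eta0 h i).toNat)) (a := l / d)
    rw [Finset.card_range] at this
    omega
  · rw [rows_eq_range hh hm i fun _ => hl, Finset.card_range]
    omega

theorem toNat_eta3_le_freeRows {d m l : ℕ} (hl : l < m) (s : Fin d → Fin d) (sd i : Fin d) :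
    (eta3 sd i).toNat ≤ freeRows m l s sd i := by
  by_cases h : (sd : ℕ) = d - i - 1
  · have hr : sd.rev = i := by
      apply Fin.ext
      have := i.2
      rw [Fin.val_rev]
      omega
    simp [freeRows, hl, hr, eta3, h]
  · simp [eta3, h]

theorem blockSum_rows_eq_PsiG {d n h m l : ℕ} (hh : h < d) (hm : m = d * n + h) (v : ℕ → ℤ)
    {s : Fin d → Fin d} {i : Fin d} (hl : l < m → l % d ≠ i) {b : ℕ}
    (hb : (rows d m l i).card + b = n + (eta1 h i).toNat + defect s i) :
    (blockSum (setJbar d v) (rows d m l i) (defect s i) (n + (eta1 h i).toNat) b : ZMod 2) =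
      PsiG d v n (eta0 h i) (eta1 h i) (eta2 s i) := by
  rw [rows_eq_range hh hm i hl] at hb ⊢
  rw [Finset.card_range] at hb
  exact blockSum_range_eq_PsiG d v n b _ _ _ hb

theorem theorem13 (d n h m : ℕ) (hd : 1 ≤ d) (hn : 2 ≤ n) (hh : h < d) (hm : m = d * n + h)
    (v : ℕ → ℤ) (hv : ∀ i < d, v i = 1 ∨ v i = -1) (hv0 : v 0 = 1) :
    (∀ s : Fin d → Fin d, IsTypeY d v m s →
      (setPY d v m s).ncard ≡ ∏ i : Fin d, muY d v n h s i [MOD 2]) ∧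
    (∀ (s : Fin d → Fin d) (sd : Fin d), IsTypeZ d v m s sd →
      (setPZ d v m s sd).ncard ≡ ∏ i : Fin d, muZ d v n h s sd i [MOD 2]) ∧
    (∀ (k : Fin d) (s : Fin d → Fin d) (sd : Fin d), IsTypeX d v m k s sd →
      cardPX d v m k s sd ≡ ∏ i : Fin d, muX d v n h k s sd i [MOD 2]) := by
  have hr : ∀ (l : ℕ) (i : Fin d), (rows d m l i).Nonempty :=
    fun l i => rows_nonempty hn hh hm i
  have hmd : 2 * d ≤ m := by
    have := Nat.mul_le_mul_left d hn
    omega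
  refine ⟨fun s hs => ?_, fun s sd hs => ?_, fun k s sd hs => ?_⟩ <;>
    rw [← ZMod.natCast_eq_natCast_iff]
  · obtain ⟨hs, σ, hσ⟩ := hs
    have hm0 : ¬ m < m := lt_irrefl m
    rw [setPY_eq_typedPerms hd ⟨0, hd⟩ hs, ncard_typedPerms_eq_prod hd hh hm _ _ _ (hr m),
      Nat.cast_prod, Nat.cast_prod]
    refine Finset.prod_congr rfl fun i _ => ?_
    exact blockSum_rows_eq_PsiG hh hm v (fun h => absurd h hm0)
      (card_rows_add_freeRows hd hh hm (hr m) hσ (fun h => absurd h hm0) i)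
  · obtain ⟨hs, σ, hσ, hσ'⟩ := hs
    have hlm : m - 1 < m := by omega
    rw [setPZ, permSetType_eq_typedPerms hd sd hs hlm,
      ncard_typedPerms_eq_prod hd hh hm _ _ _ (hr _), Nat.cast_prod, Nat.cast_prod]
    refine Finset.prod_congr rfl fun i _ => ?_
    have hb := card_rows_add_freeRows hd hh hm (hr _) hσ (fun _ => hσ') i
    rw [muZ, ← hm]
    split_ifs with hi
    · have hrow : rows d m (m - 1) i = Finset.range (n + (eta0 h i).toNat - 1) := by
        rw [rows_eq_range_erase hh hm i hi]
        have hlt : ∀ a, d * a + i < m ↔ a < n + (eta0 h i).toNat := by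
          intro a
          rw [hm, mul_add_lt_mul_add_iff i.2 hh]
          rfl
        -- The place `m - 1` is the last one of its block.
        have h1 := Nat.div_add_mod (m - 1) d
        have h2 := (hlt ((m - 1) / d)).1 (by omega)
        have h3 := (hlt ((m - 1) / d + 1)).not.1 (by
          rw [mul_add]
          omega)
        ext a
        simp only [Finset.mem_erase, Finset.mem_range]
        omega
      rw [hrow] at hb ⊢
      rw [Finset.card_range] at hb
      exact blockSum_range_eq_PsiZ d v hn _ _ _ _ _ hb (toNat_eta3_le_freeRows hlm s sd i)
    · exact blockSum_rows_eq_PsiG hh hm v (fun _ => hi) hb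
  · obtain ⟨hs, l₀, hl₀, hl₀k, σ, hσ, hσ'⟩ := hs
    have hb₀ := card_rows_add_freeRows hd hh hm (hr l₀) hσ (fun _ => hσ')
    have hfree : ∀ l < m, ∀ i, freeRows m l s sd i = freeRows m l₀ s sd i := by
      intro l hl i
      simp [freeRows, hl, hl₀]
    have hlt : ∀ a, d * a + k < m ↔ a < n + (eta0 h k).toNat := by
      intro a
      rw [hm, mul_add_lt_mul_add_iff k.2 hh]
      rfl
    -- Only the factor of the block `k` depends on `l`.
    have hterm : ∀ l ∈ (Finset.range m).filter (fun l => l % d = k),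
        ((permSetType d v m l s sd).ncard : ZMod 2) =
          (blockSum (setJbar d v) ((Finset.range (n + (eta0 h k).toNat)).erase (l / d))
            (defect s k) (n + (eta1 h k).toNat) (freeRows m l₀ s sd k) : ZMod 2) *
          ∏ i ∈ Finset.univ.erase k, (muX d v n h k s sd i : ZMod 2) := by
      intro l hl
      rw [Finset.mem_filter, Finset.mem_range] at hl
      obtain ⟨hl, hlk⟩ := hl
      rw [permSetType_eq_typedPerms hd sd hs hl, ncard_typedPerms_eq_prod hd hh hm _ _ _ (hr l),
        Nat.cast_prod, ← Finset.mul_prod_erase _ _ (Finset.mem_univ k), hfree l hl,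
        rows_eq_range_erase hh hm k hlk]
      congr 1
      refine Finset.prod_congr rfl fun i hi => ?_
      have hik : (k : ℕ) ≠ i := fun h => Finset.ne_of_mem_erase hi (Fin.ext h.symm)
      have hik' : k ≠ i := fun h => hik (congrArg Fin.val h)
      have hb := hb₀ i
      rw [rows_eq_range hh hm i fun _ => hl₀k ▸ hik,
        ← rows_eq_range (l := l) hh hm i fun _ => hlk ▸ hik] at hb
      rw [muX, if_neg hik', hfree l hl]
      exact blockSum_rows_eq_PsiG hh hm v (fun _ => hlk ▸ hik) hb
    rw [cardPX, Nat.cast_sum, Finset.sum_congr rfl hterm, ← Finset.sum_mul, Nat.cast_prod,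
      ← Finset.mul_prod_erase _ _ (Finset.mem_univ k)]
    congr 1
    have hb := hb₀ k
    rw [rows_eq_range_erase hh hm k hl₀k, Finset.card_erase_of_mem, Finset.card_range] at hb
    swap
    · rw [Finset.mem_range, ← hlt, ← hl₀k, Nat.div_add_mod]
      exact hl₀
    rw [muX, if_pos rfl, ← sum_blockSum_range_erase_eq_PsiX d v hn _ _ _ _ _ hb
      (toNat_eta3_le_freeRows hl₀ s sd k), Nat.cast_sum]
    refine Finset.sum_bij (fun l _ => l / d) ?_ ?_ ?_ fun l _ => rfl
    · intro l hl
      rw [Finset.mem_filter, Finset.mem_range] at hl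
      rw [Finset.mem_range, ← hlt, ← hl.2, Nat.div_add_mod]
      exact hl.1
    · intro l hl l' hl' h
      rw [Finset.mem_filter] at hl hl'
      exact eq_of_mod_eq_of_div_eq (hl.2.trans hl'.2.symm) h
    · intro a ha
      rw [Finset.mem_range, ← hlt] at ha
      refine ⟨d * a + k, ?_, ?_⟩
      · rw [Finset.mem_filter, Finset.mem_range, Nat.mul_add_mod, Nat.mod_eq_of_lt k.2]
        exact ⟨ha, rfl⟩
      · rw [Nat.mul_add_div hd, Nat.div_eq_of_lt k.2, add_zero]
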